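/- **Setting.** There are $m$ items, $M$ is the set of all items, and there are two bidders. A valuation is a function $v:2^M\to\mathbb R$. It is XOS if $v(S)=\max_{a\in K}a(S)$ for a finite set $K$ of additive valuations (clauses). An XOS oracle for $v$ (with respect to $K$) is a function $\mathcal O$ that maps every bundle $S$ to a clause $\mathcal O(S)\in K$ with $\mathcal O(S)(S)=v(S)$. In the simultaneous second price auction every bidder $i$ submits bids $b_i(j)\ge 0$, one for each item $j$. Every item goes to a bidder with the highest bid for it (ties are broken arbitrarily). This gives a partition $(S_1,S_2)$ of $M$, and the utility of bidder $i$ is $v_i(S_i)-\sum_{j\in S_i}b_{i'}(j)$, where $i'$ is the other bidder. A strategy $b_i$ has no overbidding if $\sum_{j\in S}b_i(j)\le v_i(S)$ for every $S\subseteq M$. A no-overbidding equilibrium consists of no-overbidding strategies $b_1,b_2$ and a resulting allocation $(S_1,S_2)$ such that no bidder can increase his utility by deviating to another no-overbidding strategy. It is traditional with respect to XOS oracles $\mathcal O_1,\mathcal O_2$ if, for each bidder $i$ and item $j$, $b_i(j)$ equals the coefficient of $j$ in $\mathcal O_i(S_i)$ when $j\in S_i$, and $b_i(j)=0$ when $j\notin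 S_i$. A deterministic query algorithm is a deterministic procedure that adaptively asks queries to the bidders, and finally outputs bids and an allocation. The allowed queries to bidder $i$ are value queries (given $S$, the answer is $v_i(S)$), demand queries (given prices $p\in\mathbb R^M$, the answer is a bundle that maximizes $v_i(S)-\sum_{j\in S}p_j$, chosen among the maximizers by a fixed tie-breaking rule that depends only on $i$, on $p$ and on the set of maximizers), and XOS queries (given $S$, the answer is $\mathcal O_i(S)$). Let $m=2m'+1$ be odd. Given, for every bundle $S$ of size $m'+1$, a number $0<k_S<\frac14$ and an item $j_S\in S$, the sensitive valuation with these parameters is the maximum of the following clauses: * for every item $j$: the clause with value $m'-20$ for $j$ and $0$ for all other items; * for every $S$ with $|S|=m'$: value $1$ for every item of $S$, $0$ otherwise; * for every $S$ with $|S|=m'+1$: value $\frac14+k_S$ for $j_S$, value $1$ for every other item of $S$, $0$ outside $S$; * for every $S$ with $|S|=m'+10$: value $\frac{m'+1}{m'+10}$ for every item of $S$, $0$ otherwise. An XOS oracle that returns only clauses from this list is called standard. **Theorem.** There are constants $c>0$ and $m_0$ such that the following holds for every odd $m\ge m_0$ and every choice of tie-breaking rules for the demand queries. Let $A$ be a deterministic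 algorithm that makes value, demand and XOS queries. Suppose that, whenever both bidders have the same sensitive valuation $v$ on $m$ items and the same standard XOS oracle $\mathcal O$ for $v$, the output of $A$ is a traditional equilibrium with respect to $\mathcal O$. Then there are a sensitive valuation $v$ and a standard XOS oracle $\mathcal O$ for $v$ such that $A$ makes at least $2^{cm}$ queries when both bidders have the valuation $v$ and the oracle $\mathcal O$. In particular, every deterministic algorithm that makes value, demand and XOS queries and always (for all XOS valuations and all XOS oracles) outputs a traditional equilibrium makes exponentially many queries in the worst case, even with two bidders who have identical sensitive valuations. -/

import Mathlib

namespace TradEq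

noncomputable section

/-! Items are `Fin m`, bundles are `Finset (Fin m)`, the two bidders are `Fin 2`. -/

/-- A valuation assigns a real value to every bundle. -/
abbrev Valuation (m : ℕ) := Finset (Fin m) → ℝ

/-- An additive valuation (a clause), given by its coefficients ("prices") on the items. -/
abbrev Clause (m : ℕ) := Fin m → ℝ

/-- The value that an additive valuation gives to a bundle. -/
def Clause.value {m : ℕ} (a : Clause m) (S : Finset (Fin m)) : ℝ := ∑ j ∈ S, a j

/-- The XOS valuation `S ↦ max_{a ∈ K} a(S)` of a finite nonempty set of clauses `K`. -/
def xosValuation {m : ℕ} (K : Set (Clause m)) : Valuation m :=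
  fun S => sSup ((fun a : Clause m => a.value S) '' K)

/-- `O` is an XOS oracle for the valuation given by the clauses `K`: on every bundle `S` it
returns a maximizing clause, i.e. some `a ∈ K` with `v(S) = a(S)`. -/
def IsXOSOracle {m : ℕ} (K : Set (Clause m)) (O : Finset (Fin m) → Clause m) : Prop :=
  ∀ S, O S ∈ K ∧ (O S).value S = xosValuation K S

/-! ### Simultaneous second price auctions with two bidders -/

/-- The other bidder. -/
def opponent (i : Fin 2) : Fin 2 := 1 - i

/-- `S` is a possible outcome of the auction under the bids `b`: every item is given to exactly
one bidder, who has a maximal bid for it (ties are broken arbitrarily). -/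
def IsOutcome {m : ℕ} (b : Fin 2 → Fin m → ℝ) (S : Fin 2 → Finset (Fin m)) : Prop :=
  Disjoint (S 0) (S 1) ∧ S 0 ∪ S 1 = Finset.univ ∧
    ∀ i, ∀ j ∈ S i, b (opponent i) j ≤ b i j

/-- The utility of bidder `i`: the value of the items won minus the second price payments. -/
def utility {m : ℕ} (v : Fin 2 → Valuation m) (b : Fin 2 → Fin m → ℝ)
    (S : Fin 2 → Finset (Fin m)) (i : Fin 2) : ℝ :=
  v i (S i) - ∑ j ∈ S i, b (opponent i) j

/-- An admissible strategy for a bidder with valuation `v`: nonnegative bids, no overbidding. -/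
def IsNoOverbidding {m : ℕ} (v : Valuation m) (b : Fin m → ℝ) : Prop :=
  (∀ j, 0 ≤ b j) ∧ ∀ S : Finset (Fin m), ∑ j ∈ S, b j ≤ v S

/-- What an equilibrium-finding algorithm outputs: the bids and the resulting allocation. -/
structure Profile (m : ℕ) where
  bid : Fin 2 → Fin m → ℝ
  alloc : Fin 2 → Finset (Fin m)

/-- A pure no-overbidding equilibrium: no bidder can gain by a unilateral deviation to another
no-overbidding strategy. -/
def IsNoOverbiddingEquilibrium {m : ℕ} (v : Fin 2 → Valuation m) (P : Profile m) : Prop :=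
  IsOutcome P.bid P.alloc ∧
  (∀ i, IsNoOverbidding (v i) (P.bid i)) ∧
  ∀ (i : Fin 2) (b' : Fin m → ℝ), IsNoOverbidding (v i) b' →
    ∀ S' : Fin 2 → Finset (Fin m), IsOutcome (Function.update P.bid i b') S' →
      utility v (Function.update P.bid i b') S' i ≤ utility v P.bid P.alloc i

/-- A no-overbidding equilibrium is traditional with respect to the XOS oracles `O i` if every
bidder bids on the items allocated to him the prices of the clause that his oracle returns for
his bundle, and `0` on all the other items. -/
def IsTraditionalEquilibrium {m : ℕ} (v : Fin 2 → Valuation m)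
    (O : Fin 2 → Finset (Fin m) → Clause m) (P : Profile m) : Prop :=
  IsNoOverbiddingEquilibrium v P ∧
  ∀ i j, (j ∈ P.alloc i → P.bid i j = O i (P.alloc i) j) ∧ (j ∉ P.alloc i → P.bid i j = 0)

/-! ### Queries and deterministic algorithms -/

/-- The bundles that maximize `v(S) - ∑_{j ∈ S} p_j`. -/
def demandSet {m : ℕ} (v : Valuation m) (p : Fin m → ℝ) : Finset (Finset (Fin m)) :=
  open Classical in
  Finset.univ.filter fun S => ∀ T : Finset (Fin m), v T - ∑ j ∈ T, p j ≤ v S - ∑ j ∈ S, p j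

/-- How ties are broken in demand queries: given the prices and the set of all profit-maximizing
bundles, one of these bundles is selected. -/
structure TieBreaking (m : ℕ) where
  select : (Fin m → ℝ) → Finset (Finset (Fin m)) → Finset (Fin m)
  select_mem : ∀ p F, F.Nonempty → select p F ∈ F

/-- A query to one of the bidders. -/
inductive Query (m : ℕ) : Type
  | value (i : Fin 2) (S : Finset (Fin m)) : Query m
  | demand (i : Fin 2) (p : Fin m → ℝ) : Query m
  | xos (i : Fin 2) (S : Finset (Fin m)) : Query m

/-- The type of the answers to a query. -/
def Query.Answer {m : ℕ} : Query m → Type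
  | .value _ _ => ℝ
  | .demand _ _ => Finset (Fin m)
  | .xos _ _ => Clause m

/-- The answer to a query if the bidders have the valuations `v i`, the XOS oracles `O i`, and
the tie breaking rules `τ i`. -/
def Query.answer {m : ℕ} (v : Fin 2 → Valuation m) (O : Fin 2 → Finset (Fin m) → Clause m)
    (τ : Fin 2 → TieBreaking m) : (q : Query m) → q.Answer
  | .value i S => v i S
  | .demand i p => (τ i).select p (demandSet (v i) p)
  | .xos i S => O i S

/-- A deterministic adaptive query algorithm (a decision tree): it stops with an output, or asks
a query and continues depending on the answer. -/
inductive Algorithm (m : ℕ) : Type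
  | output (P : Profile m) : Algorithm m
  | ask (q : Query m) (next : q.Answer → Algorithm m) : Algorithm m

/-- The output of an algorithm when the queries are answered according to `ans`. -/
def Algorithm.run {m : ℕ} (ans : (q : Query m) → q.Answer) : Algorithm m → Profile m
  | .output P => P
  | .ask q next => (next (ans q)).run ans

/-- The number of queries that an algorithm makes when they are answered according to `ans`. -/
def Algorithm.queryCount {m : ℕ} (ans : (q : Query m) → q.Answer) : Algorithm m → ℕ
  | .output _ => 0
  | .ask q next => (next (ans q)).queryCount ans + 1

/-! ### Sensitive valuations

Here `m` is odd and `m' = m / 2` (rounded down), so that `m = 2 m' + 1`. -/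

/-- The parameters of a sensitive valuation: for every bundle `S` of size `m' + 1` a number
`0 < k_S < 1/4` and one item `j_S ∈ S`. (The values at other bundles play no role.) -/
structure Sensitive (m : ℕ) where
  k : Finset (Fin m) → ℝ
  item : Finset (Fin m) → Fin m
  k_pos : ∀ S, S.card = m / 2 + 1 → 0 < k S
  k_lt : ∀ S, S.card = m / 2 + 1 → k S < 1 / 4
  item_mem : ∀ S, S.card = m / 2 + 1 → item S ∈ S

/-- `C_j`: value `m' - 20` for `j` and `0` for every other item. -/
def clauseC (m : ℕ) (j : Fin m) : Clause m :=
  fun x => if x = j then ((m / 2 : ℕ) : ℝ) - 20 else 0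

/-- `A_S`: value `1` for every item of `S`, `0` for the others. -/
def clauseA {m : ℕ} (S : Finset (Fin m)) : Clause m :=
  fun x => if x ∈ S then 1 else 0

/-- `M_{S,j}`: value `1/4 + k_S` for `j`, `1` for the other items of `S`, `0` outside `S`. -/
def clauseM {m : ℕ} (S : Finset (Fin m)) (j : Fin m) (kS : ℝ) : Clause m :=
  fun x => if x = j then 1 / 4 + kS else if x ∈ S then 1 else 0

/-- `B_S`: value `(m' + 1) / (m' + 10)` for every item of `S`, `0` for the others. -/
def clauseB {m : ℕ} (S : Finset (Fin m)) : Clause m :=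
  fun x => if x ∈ S then (((m / 2 : ℕ) : ℝ) + 1) / (((m / 2 : ℕ) : ℝ) + 10) else 0

/-- The clauses that define a sensitive valuation. -/
def Sensitive.clauses {m : ℕ} (d : Sensitive m) : Set (Clause m) :=
  {a | ∃ j : Fin m, a = clauseC m j} ∪
  {a | ∃ S : Finset (Fin m), S.card = m / 2 ∧ a = clauseA S} ∪
  {a | ∃ S : Finset (Fin m), S.card = m / 2 + 1 ∧ a = clauseM S (d.item S) (d.k S)} ∪
  {a | ∃ S : Finset (Fin m), S.card = m / 2 + 10 ∧ a = clauseB S}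

/-- The sensitive valuation with the given parameters. -/
def Sensitive.valuation {m : ℕ} (d : Sensitive m) : Valuation m := xosValuation d.clauses

/-- The set of clauses of a sensitive valuation is finite, hence the supremum that defines the
valuation is a maximum. -/
theorem Sensitive.clauses_finite {m : ℕ} (d : Sensitive m) : d.clauses.Finite := by
  have h (p : Finset (Fin m) → Prop) (f : Finset (Fin m) → Clause m) :
      {a | ∃ S, p S ∧ a = f S}.Finite :=
    (Set.finite_range f).subset (by rintro _ ⟨S, -, rfl⟩; exact ⟨S, rfl⟩)
  refine (((?_ : Set.Finite _).union (h _ _)).union (h _ _)).union (h _ _)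
  exact (Set.finite_range (clauseC m)).subset (by rintro _ ⟨j, rfl⟩; exact ⟨j, rfl⟩)

theorem Sensitive.clauses_nonempty {m : ℕ} (d : Sensitive m) : d.clauses.Nonempty := by
  obtain ⟨S, -, hS⟩ := Finset.exists_subset_card_eq
    (s := (Finset.univ : Finset (Fin m))) (n := m / 2) (by simpa using Nat.div_le_self m 2)
  exact ⟨clauseA S, Or.inl (Or.inl (Or.inr ⟨S, hS, rfl⟩))⟩

theorem Sensitive.isGreatest_valuation {m : ℕ} (d : Sensitive m) (S : Finset (Fin m)) :
    IsGreatest ((fun a : Clause m => a.value S) '' d.clauses) (d.valuation S) :=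
  have hf := d.clauses_finite.image (fun a : Clause m => a.value S)
  ⟨(d.clauses_nonempty.image _).csSup_mem hf, fun _ hx => le_csSup hf.bddAbove hx⟩

end

end TradEq

open Finset
namespace TradEq

/-! ### XOS valuations of finite sets of clauses -/

section XOS

variable {m : ℕ} {K K' : Set (Clause m)}

/-! Write m' = m / 2. Bundles of size m' + 1 are the vertices of the odd graph, where S is joined to
Sᶜ ∪ {j} for j ∈ S. The proof embeds a local search problem on this graph and shows that the search
is hard even with demand and XOS queries.

Equilibria are local maxima (`IsTraditionalEquilibrium.exists_local_max`). The smaller bidder faces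
the prices of a clause maximal on the other bundle S. A clause B_T, or M_T with T ≠ S, leaves a
profitable deviation, so |S| = m' + 1 and the clause is M_S. Buying j_S at price 1/4 + k_S must not
pay, and this bounds k at Sᶜ ∪ {j_S} by k_S.

Queries are local (`Sensitive.answer_congr`). M_T matters on a bundle only if that bundle is T plus
a few items. In a demand query such a bundle must nearly equal the set of cheap items. Hence, for a
suitable oracle, an answer depends only on parameters within bounded distance of one center, which
are polynomially many.

The adversary (`Ranking.Climbs.exists_adversary`) keeps a live region whose parameters are still
free. Revealed bundles leave it, and every dead bundle gets an item leading to a neighbor of larger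
rank, so none is a local maximum. This requires that the smaller region can be reached from
everywhere in the old one. The region is a grid: two families of connected lines, each line of one
crossing each line of the other (`Splitting.reachIn_live`). A bundle destroys at most one line per
family, so about binom(m', m'/2) bundles must be revealed before a family is exhausted. -/

theorem Clause.value_le_xosValuation (hK : K.Finite) {a : Clause m} (ha : a ∈ K)
    (S : Finset (Fin m)) : a.value S ≤ xosValuation K S :=
  le_csSup (hK.image _).bddAbove ⟨a, ha, rfl⟩

theorem exists_value_eq_xosValuation (hK : K.Finite) (hne : K.Nonempty) (S : Finset (Fin m)) :
    ∃ a ∈ K, a.value S = xosValuation K S :=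
  (hne.image _).csSup_mem (hK.image (fun a : Clause m => a.value S))

theorem xosValuation_mono (hK : K.Finite) (hne : K'.Nonempty) (hsub : K' ⊆ K)
    (S : Finset (Fin m)) : xosValuation K' S ≤ xosValuation K S := by
  obtain ⟨a, ha, h⟩ := exists_value_eq_xosValuation (hK.subset hsub) hne S
  exact h ▸ Clause.value_le_xosValuation hK (hsub ha) S

/-- Dropping clauses that are dominated on `S` does not change the value of `S`. -/
theorem xosValuation_eq_of_dominated (hK : K.Finite) (hne : K'.Nonempty) (hsub : K' ⊆ K)
    {S : Finset (Fin m)} (hdom : ∀ a ∈ K, ∃ b ∈ K', a.value S ≤ b.value S) :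
    xosValuation K S = xosValuation K' S := by
  refine le_antisymm ?_ (xosValuation_mono hK hne hsub S)
  obtain ⟨a, ha, h⟩ := exists_value_eq_xosValuation hK (hne.mono hsub) S
  obtain ⟨b, hb, hab⟩ := hdom a ha
  exact h ▸ hab.trans (Clause.value_le_xosValuation (hK.subset hsub) hb S)

theorem mem_demandSet {v : Valuation m} {p : Fin m → ℝ} {S : Finset (Fin m)} :
    S ∈ demandSet v p ↔ ∀ T, v T - ∑ j ∈ T, p j ≤ v S - ∑ j ∈ S, p j := by
  simp [demandSet]

/-- Dropping clauses that are on every bundle dominated or not profit maximizing does not change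
the demand. -/
theorem demandSet_eq_of_dominated (hK : K.Finite) (hne : K'.Nonempty) (hsub : K' ⊆ K)
    {p : Fin m → ℝ}
    (hdom : ∀ a ∈ K, ∀ S, (∃ b ∈ K', a.value S ≤ b.value S) ∨
      ∃ b ∈ K', ∃ S', a.value S - ∑ j ∈ S, p j < b.value S' - ∑ j ∈ S', p j) :
    demandSet (xosValuation K) p = demandSet (xosValuation K') p := by
  have hK' := hK.subset hsub
  ext S
  rw [mem_demandSet, mem_demandSet]
  constructor
  · intro h T
    obtain ⟨a, ha, haS⟩ := exists_value_eq_xosValuation hK (hne.mono hsub) S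
    have hT := xosValuation_mono hK hne hsub T
    have h1 := h T
    rcases hdom a ha S with ⟨b, hb, hab⟩ | ⟨b, hb, S', hlt⟩
    · have := Clause.value_le_xosValuation hK' hb S
      linarith
    · have := Clause.value_le_xosValuation hK (hsub hb) S'
      have := h S'
      linarith
  · intro h T
    obtain ⟨a, ha, haT⟩ := exists_value_eq_xosValuation hK (hne.mono hsub) T
    have hS := xosValuation_mono hK hne hsub S
    have h1 := h T
    rcases hdom a ha T with ⟨b, hb, hab⟩ | ⟨b, hb, S', hlt⟩
    · have := Clause.value_le_xosValuation hK' hb T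
      linarith
    · have := Clause.value_le_xosValuation hK' hb S'
      have := h S'
      linarith

open Classical in
/-- A clause of `K` that is maximal on `S`. -/
noncomputable def maxClause (K : Set (Clause m)) (S : Finset (Fin m)) : Clause m :=
  if h : ∃ a ∈ K, a.value S = xosValuation K S then h.choose else 0

theorem maxClause_spec (hK : K.Finite) (hne : K.Nonempty) (S : Finset (Fin m)) :
    maxClause K S ∈ K ∧ (maxClause K S).value S = xosValuation K S := by
  have h := exists_value_eq_xosValuation hK hne S
  rw [maxClause, dif_pos h]
  exact h.choose_spec

end XOS

/-! ### Values of the clauses of a sensitive valuation -/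

section Clauses

variable {m : ℕ}

theorem Clause.value_mono {a b : Clause m} (h : ∀ x, a x ≤ b x) (S : Finset (Fin m)) :
    a.value S ≤ b.value S :=
  Finset.sum_le_sum fun x _ => h x

theorem clauseC_value (j : Fin m) (S : Finset (Fin m)) :
    (clauseC m j).value S = if j ∈ S then ((m / 2 : ℕ) : ℝ) - 20 else 0 := by
  simp [Clause.value, clauseC]

theorem clauseA_value (T S : Finset (Fin m)) : (clauseA T).value S = ((S ∩ T).card : ℝ) := by
  simp [Clause.value, clauseA]

theorem clauseB_value (T S : Finset (Fin m)) :
    (clauseB T).value S =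
      ((S ∩ T).card : ℝ) * ((((m / 2 : ℕ) : ℝ) + 1) / (((m / 2 : ℕ) : ℝ) + 10)) := by
  simp [Clause.value, clauseB]

theorem clauseB_ratio_lt_one : (((m / 2 : ℕ) : ℝ) + 1) / (((m / 2 : ℕ) : ℝ) + 10) < 1 := by
  rw [div_lt_one (by positivity)]
  linarith

theorem clauseB_ratio_nonneg : 0 ≤ (((m / 2 : ℕ) : ℝ) + 1) / (((m / 2 : ℕ) : ℝ) + 10) := by
  positivity

theorem clauseB_value_of_subset {T S : Finset (Fin m)} (hT : T.card = m / 2 + 10) (h : T ⊆ S) :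
    (clauseB T).value S = ((m / 2 : ℕ) : ℝ) + 1 := by
  rw [clauseB_value, inter_eq_right.2 h, hT]
  push_cast
  field_simp

theorem clauseB_le_clauseA (T : Finset (Fin m)) (x : Fin m) : clauseB T x ≤ clauseA T x := by
  have := @clauseB_ratio_lt_one m
  unfold clauseB clauseA
  split_ifs <;> linarith

theorem clauseM_le_clauseA {T : Finset (Fin m)} {j : Fin m} {κ : ℝ} (hj : j ∈ T) (hκ : κ < 1 / 4)
    (x : Fin m) : clauseM T j κ x ≤ clauseA T x := by
  unfold clauseM clauseA
  split_ifs <;> first | linarith | (subst_vars; contradiction)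

theorem clauseM_nonneg {T : Finset (Fin m)} {j : Fin m} {κ : ℝ} (hκ : 0 < κ)
    (x : Fin m) : 0 ≤ clauseM T j κ x := by
  unfold clauseM
  split_ifs <;> linarith

theorem clauseM_value_of_subset {T S : Finset (Fin m)} {j : Fin m} {κ : ℝ}
    (hT : T.card = m / 2 + 1) (hj : j ∈ T) (h : T ⊆ S) :
    (clauseM T j κ).value S = ((m / 2 : ℕ) : ℝ) + 1 / 4 + κ := by
  have h1 : (clauseM T j κ).value S = (clauseM T j κ).value T := by
    refine (Finset.sum_subset h fun x _ hx => ?_).symm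
    have : x ≠ j := fun e => hx (e ▸ hj)
    simp [clauseM, this, hx]
  rw [h1, Clause.value, ← Finset.add_sum_erase _ _ hj,
    Finset.sum_congr rfl (g := fun _ => (1 : ℝ))]
  · simp [clauseM, card_erase_of_mem hj, hT]
    ring
  · intro x hx
    rw [mem_erase] at hx
    simp [clauseM, hx.1, hx.2]

theorem clauseM_value_le {T : Finset (Fin m)} {j : Fin m} {κ : ℝ}
    (hT : T.card = m / 2 + 1) (hj : j ∈ T) (hκ : 0 < κ) (S : Finset (Fin m)) :
    (clauseM T j κ).value S ≤ ((m / 2 : ℕ) : ℝ) + 1 / 4 + κ := by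
  rw [← clauseM_value_of_subset hT hj (subset_univ T)]
  exact Finset.sum_le_sum_of_subset_of_nonneg (subset_univ S) fun x _ _ => clauseM_nonneg hκ x

theorem clauseM_value_le_card {T : Finset (Fin m)} {j : Fin m} {κ : ℝ}
    (hj : j ∈ T) (hκ : κ < 1 / 4) (S : Finset (Fin m)) :
    (clauseM T j κ).value S ≤ ((S ∩ T).card : ℝ) := by
  rw [← clauseA_value]
  exact Clause.value_mono (clauseM_le_clauseA hj hκ) S

/-- The clauses that all sensitive valuations on `m` items have in common. -/
def baseClauses (m : ℕ) : Set (Clause m) :=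
  {a | ∃ j : Fin m, a = clauseC m j} ∪
  {a | ∃ S : Finset (Fin m), S.card = m / 2 ∧ a = clauseA S} ∪
  {a | ∃ S : Finset (Fin m), S.card = m / 2 + 10 ∧ a = clauseB S}

/-- The common clauses together with the clauses `M_T` for `T ∈ R`. -/
def Sensitive.clausesOn (d : Sensitive m) (R : Set (Finset (Fin m))) : Set (Clause m) :=
  baseClauses m ∪
    {a | ∃ T ∈ R, T.card = m / 2 + 1 ∧ a = clauseM T (d.item T) (d.k T)}

theorem clauseC_mem_base (j : Fin m) : clauseC m j ∈ baseClauses m := Or.inl (Or.inl ⟨j, rfl⟩)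

theorem clauseA_mem_base {S : Finset (Fin m)} (h : S.card = m / 2) :
    clauseA S ∈ baseClauses m := Or.inl (Or.inr ⟨S, h, rfl⟩)

theorem clauseB_mem_base {S : Finset (Fin m)} (h : S.card = m / 2 + 10) :
    clauseB S ∈ baseClauses m := Or.inr ⟨S, h, rfl⟩

theorem baseClauses_nonempty (m : ℕ) : (baseClauses m).Nonempty := by
  obtain ⟨S, -, hS⟩ := Finset.exists_subset_card_eq
    (s := (Finset.univ : Finset (Fin m))) (n := m / 2) (by simpa using Nat.div_le_self m 2)
  exact ⟨_, clauseA_mem_base hS⟩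

theorem Sensitive.clausesOn_nonempty (d : Sensitive m) (R : Set (Finset (Fin m))) :
    (d.clausesOn R).Nonempty := (baseClauses_nonempty m).mono Set.subset_union_left

theorem Sensitive.mem_clauses {d : Sensitive m} {a : Clause m} :
    a ∈ d.clauses ↔ a ∈ baseClauses m ∨
      ∃ T : Finset (Fin m), T.card = m / 2 + 1 ∧ a = clauseM T (d.item T) (d.k T) := by
  simp only [Sensitive.clauses, baseClauses, Set.mem_union, Set.mem_ofPred_eq]
  exact or_right_comm

theorem Sensitive.clausesOn_subset (d : Sensitive m) (R : Set (Finset (Fin m))) :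
    d.clausesOn R ⊆ d.clauses := by
  rintro a (h | ⟨T, -, h⟩)
  · exact mem_clauses.2 (Or.inl h)
  · exact mem_clauses.2 (Or.inr ⟨T, h⟩)

theorem Sensitive.clausesOn_congr {d d' : Sensitive m} {R : Set (Finset (Fin m))}
    (h : ∀ T ∈ R, T.card = m / 2 + 1 → d.k T = d'.k T ∧ d.item T = d'.item T) :
    d.clausesOn R = d'.clausesOn R := by
  unfold Sensitive.clausesOn
  congr 1
  ext a
  constructor
  · rintro ⟨T, hR, hT, rfl⟩
    exact ⟨T, hR, hT, by rw [(h T hR hT).1, (h T hR hT).2]⟩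
  · rintro ⟨T, hR, hT, rfl⟩
    exact ⟨T, hR, hT, by rw [(h T hR hT).1, (h T hR hT).2]⟩

/-- On a bundle `S`, the clause `M_T` is dominated by a common clause unless `T ⊆ S` and `S` has
at most `m' + 9` items. -/
theorem clauseM_dominated_or {T : Finset (Fin m)} {j : Fin m} {κ : ℝ}
    (hT : T.card = m / 2 + 1) (hj : j ∈ T) (hκ : 0 < κ) (hκ' : κ < 1 / 4) (S : Finset (Fin m)) :
    (∃ b ∈ baseClauses m, (clauseM T j κ).value S ≤ b.value S) ∨
      (T ⊆ S ∧ S.card ≤ m / 2 + 9) := by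
  by_cases hTS : T ⊆ S
  · by_cases hS : S.card ≤ m / 2 + 9
    · exact Or.inr ⟨hTS, hS⟩
    · obtain ⟨U, hU, hUc⟩ := Finset.exists_subset_card_eq (s := S) (n := m / 2 + 10) (by omega)
      refine Or.inl ⟨_, clauseB_mem_base hUc, ?_⟩
      -- B_U is worth m' + 1 here, while M_T never exceeds m' + 1/4 + κ < m' + 1/2.
      rw [clauseB_value_of_subset hUc hU]
      linarith [clauseM_value_le hT hj hκ S]
  · have hlt : (S ∩ T).card < T.card := by
      refine card_lt_card (Finset.ssubset_iff_subset_ne.2 ⟨inter_subset_right, fun h => hTS ?_⟩)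
      exact inter_eq_right.1 h
    -- M_T now counts at most m' items of S, each with coefficient at most 1, so a clause A_U with U
    -- ⊇ S ∩ T does as well.
    obtain ⟨U, hU, -, hUc⟩ := Finset.exists_subsuperset_card_eq (n := m / 2)
      (subset_univ (S ∩ T)) (by omega) (by simpa using Nat.div_le_self m 2)
    refine Or.inl ⟨_, clauseA_mem_base hUc, (clauseM_value_le_card hj hκ' S).trans ?_⟩
    rw [clauseA_value]
    exact_mod_cast card_le_card (subset_inter inter_subset_left hU)

end Clauses

/-! ### Every query depends on few parameters -/

section Locality

variable {m : ℕ}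

/-- The bundles whose symmetric difference with `L` has at most `400` items. -/
def near (L : Finset (Fin m)) : Set (Finset (Fin m)) := {T | (symmDiff T L).card ≤ 400}

theorem card_symmDiff_le (T L : Finset (Fin m)) :
    (symmDiff T L).card ≤ (T \ L).card + (L \ T).card := card_union_le _ _

/-- An undominated M_T has T ⊆ S and |S| ≤ m' + 9, hence |S \ T| ≤ 8, well within the radius of
`near`. -/
theorem Sensitive.valuation_eq (d : Sensitive m) (S : Finset (Fin m)) :
    d.valuation S = xosValuation (d.clausesOn (near S)) S := by
  refine xosValuation_eq_of_dominated d.clauses_finite (d.clausesOn_nonempty _)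
    (d.clausesOn_subset _) fun a ha => ?_
  rcases Sensitive.mem_clauses.1 ha with h | ⟨T, hT, rfl⟩
  · exact ⟨a, Or.inl h, le_rfl⟩
  · rcases clauseM_dominated_or hT (d.item_mem T hT) (d.k_pos T hT) (d.k_lt T hT) S with
      ⟨b, hb, hle⟩ | ⟨hTS, hS⟩
    · exact ⟨b, Or.inl hb, hle⟩
    · refine ⟨_, Or.inr ⟨T, ?_, hT, rfl⟩, le_rfl⟩
      have h1 := card_symmDiff_le T S
      have h2 := card_sdiff_add_card_eq_card hTS
      rw [sdiff_eq_empty_iff_subset.2 hTS, card_empty] at h1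
      simp only [near, Set.mem_ofPred_eq]
      omega

/-- The items that are cheap for the prices `p`. -/
noncomputable def cheap (p : Fin m → ℝ) : Finset (Fin m) := univ.filter fun j => p j < 1 / 18

theorem card_mul_le_sum_of_le {s : Finset (Fin m)} {p : Fin m → ℝ} {c : ℝ} (h : ∀ j ∈ s, c ≤ p j) :
    s.card * c ≤ ∑ j ∈ s, p j := by
  simpa using Finset.card_nsmul_le_sum s p c h

/-- If the clause `M_T` gives a maximal profit on `S ⊇ T` then `S` consists of the cheap items, up
to few exceptions. -/
theorem near_cheap_of_profit_maximal (hm : Odd m) (hm' : 40 ≤ m) {p : Fin m → ℝ}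
    {T S : Finset (Fin m)} {j : Fin m} {κ : ℝ}
    (hT : T.card = m / 2 + 1) (hj : j ∈ T) (hκ' : κ < 1 / 4)
    (hTS : T ⊆ S) (hS : S.card ≤ m / 2 + 9)
    (hmax : ∀ b ∈ baseClauses m, ∀ S',
      b.value S' - ∑ j ∈ S', p j ≤ (clauseM T j κ).value S - ∑ j ∈ S, p j) :
    T ∈ near (cheap p) := by
  rw [clauseM_value_of_subset hT hj hTS] at hmax
  have h2m : m = 2 * (m / 2) + 1 := by obtain ⟨k, rfl⟩ := hm; omega
  have hTS' := card_sdiff_add_card_eq_card hTS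
  -- the expensive items of `S`
  have hexp : (S \ cheap p).card ≤ 370 := by
    by_contra! hc
    obtain ⟨Z, hZ, hZc⟩ := Finset.exists_subset_card_eq (s := S \ cheap p) (n := 370) (by omega)
    obtain ⟨x, hx, hxZ⟩ := Finset.exists_mem_notMem_of_card_lt_card (hZc ▸ hc)
    have hZS : Z ⊆ S := hZ.trans sdiff_subset
    have h1 := hmax _ (clauseC_mem_base x) (S \ Z)
    rw [clauseC_value, if_pos (by simp [hxZ, (mem_sdiff.1 hx).1])] at h1
    have h2 := Finset.sum_sdiff hZS (f := p)
    have h3 := card_mul_le_sum_of_le (s := Z) (p := p) (c := 1 / 18) fun y hy => by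
      simpa [cheap] using (mem_sdiff.1 (hZ hy)).2
    rw [hZc] at h3
    norm_num at h3
    linarith
  -- the cheap items outside `S`
  have hch : (cheap p \ S).card ≤ 8 := by
    by_contra! hc
    obtain ⟨Z, hZ, hZc⟩ := Finset.exists_subset_card_eq (s := cheap p \ S)
      (n := m / 2 + 10 - S.card) (by omega)
    have hd : Disjoint S Z := disjoint_of_subset_right hZ disjoint_sdiff
    have hU : (S ∪ Z).card = m / 2 + 10 := by rw [card_union_of_disjoint hd]; omega
    have h1 := hmax _ (clauseB_mem_base hU) (S ∪ Z)
    rw [clauseB_value_of_subset hU subset_rfl, Finset.sum_union hd] at h1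
    have h3 : ∑ y ∈ Z, p y ≤ Z.card • (1 / 18 : ℝ) := Finset.sum_le_card_nsmul _ _ _ fun y hy => by
      have := (mem_sdiff.1 (hZ hy)).1
      simp only [cheap, mem_filter] at this
      exact this.2.le
    have h4 : (Z.card : ℝ) ≤ 9 := by
      have : Z.card ≤ 9 := by omega
      exact_mod_cast this
    rw [nsmul_eq_mul] at h3
    linarith
  -- In total at most 370 + 8 + 8 items, the last 8 for S \ T.
  have h1 := card_symmDiff_le T (cheap p)
  have h2 : (T \ cheap p).card ≤ (S \ cheap p).card := card_le_card (sdiff_subset_sdiff hTS subset_rfl)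
  have h3 : (cheap p \ T).card ≤ (cheap p \ S).card + (S \ T).card := by
    refine (card_le_card fun x hx => ?_).trans (card_union_le _ _)
    simp only [mem_union, mem_sdiff] at hx ⊢
    tauto
  simp only [near, Set.mem_ofPred_eq]
  omega

theorem Sensitive.demandSet_eq (hm : Odd m) (hm' : 40 ≤ m) (d : Sensitive m) (p : Fin m → ℝ) :
    demandSet d.valuation p = demandSet (xosValuation (d.clausesOn (near (cheap p)))) p := by
  refine demandSet_eq_of_dominated d.clauses_finite (d.clausesOn_nonempty _)
    (d.clausesOn_subset _) fun a ha S => ?_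
  rcases Sensitive.mem_clauses.1 ha with h | ⟨T, hT, rfl⟩
  · exact Or.inl ⟨a, Or.inl h, le_rfl⟩
  · rcases clauseM_dominated_or hT (d.item_mem T hT) (d.k_pos T hT) (d.k_lt T hT) S with
      ⟨b, hb, hle⟩ | ⟨hTS, hS⟩
    · exact Or.inl ⟨b, Or.inl hb, hle⟩
    · by_cases hn : T ∈ near (cheap p)
      · exact Or.inl ⟨_, Or.inr ⟨T, hn, hT, rfl⟩, le_rfl⟩
      · refine Or.inr ?_
        by_contra! hc
        exact hn (near_cheap_of_profit_maximal hm hm' hT (d.item_mem T hT) (d.k_lt T hT) hTS hS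
          fun b hb S' => hc b (Or.inl hb) S')

/-- An XOS oracle whose answers depend on few parameters. -/
noncomputable def Sensitive.localOracle (d : Sensitive m) (S : Finset (Fin m)) : Clause m :=
  maxClause (d.clausesOn (near S)) S

theorem Sensitive.isXOSOracle_localOracle (d : Sensitive m) :
    IsXOSOracle d.clauses d.localOracle := by
  intro S
  obtain ⟨h1, h2⟩ := maxClause_spec (d.clauses_finite.subset (d.clausesOn_subset (near S)))
    (d.clausesOn_nonempty _) S
  exact ⟨d.clausesOn_subset _ h1, h2.trans (d.valuation_eq S).symm⟩

/-- The bundle around which a query reveals parameters. -/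
noncomputable def Query.center : Query m → Finset (Fin m)
  | .value _ S => S
  | .demand _ p => cheap p
  | .xos _ S => S

/-- The answers to the queries for a sensitive valuation with the oracle `localOracle`. -/
noncomputable abbrev Sensitive.answer (d : Sensitive m) (τ : Fin 2 → TieBreaking m) (q : Query m) :
    q.Answer :=
  Query.answer (fun _ => d.valuation) (fun _ => d.localOracle) τ q

/-- The adversary needs only this fact about queries. For XOS queries it relies on `localOracle`,
which picks its clause from the nearby ones alone; an arbitrary oracle could leak distant parameters
through its choices among maximal clauses. -/
theorem Sensitive.answer_congr (hm : Odd m) (hm' : 40 ≤ m) {d d' : Sensitive m}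
    (τ : Fin 2 → TieBreaking m) (q : Query m)
    (h : ∀ T ∈ near q.center, T.card = m / 2 + 1 → d.k T = d'.k T ∧ d.item T = d'.item T) :
    d.answer τ q = d'.answer τ q := by
  have hc := Sensitive.clausesOn_congr h
  cases q with
  | value i S =>
    simp only [Query.center] at hc
    simp only [Sensitive.answer, Query.answer, Sensitive.valuation_eq, hc]
    rfl
  | demand i p =>
    simp only [Query.center] at hc
    simp only [Sensitive.answer, Query.answer, Sensitive.demandSet_eq hm hm', hc]
    rfl
  | xos i S =>
    simp only [Query.center] at hc
    simp only [Sensitive.answer, Query.answer, Sensitive.localOracle, hc]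
    rfl

/-- A set of at most r items is listed by a map `Fin r → Option (Fin m)`, padded with `none`. -/
theorem card_filter_card_le (m r : ℕ) :
    (univ.filter fun S : Finset (Fin m) => S.card ≤ r).card ≤ (m + 1) ^ r := by
  classical
  have : (univ.filter fun S : Finset (Fin m) => S.card ≤ r) ⊆
      (univ : Finset (Fin r → Option (Fin m))).image
        fun f => univ.filter fun j => ∃ i, f i = some j := by
    intro S hS
    rw [mem_filter] at hS
    rw [mem_image]
    obtain ⟨n, hn⟩ : ∃ n, S.card = n := ⟨_, rfl⟩
    let e := S.equivFinOfCardEq hn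
    refine ⟨fun i => if h : i.1 < n then some (e.symm ⟨i, h⟩).1 else none, mem_univ _, ?_⟩
    ext j
    simp only [mem_filter, mem_univ, true_and]
    constructor
    · rintro ⟨i, hi⟩
      split_ifs at hi with h
      rw [Option.some.injEq] at hi
      exact hi ▸ (e.symm ⟨i, h⟩).2
    · intro hj
      refine ⟨⟨e ⟨j, hj⟩, (e ⟨j, hj⟩).2.trans_le (hn ▸ hS.2)⟩, ?_⟩
      simp
  refine (card_le_card this).trans (card_image_le.trans ?_)
  simp

open Classical in
theorem card_near_le (L : Finset (Fin m)) :
    (univ.filter fun T => T ∈ near L).card ≤ (m + 1) ^ 400 := by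
  refine le_trans ?_ (card_filter_card_le m 400)
  refine card_le_card_of_injOn (fun T => symmDiff T L) (fun T hT => ?_)
    fun _ _ _ _ h => symmDiff_left_injective L h
  rw [mem_coe, mem_filter] at *
  exact ⟨mem_univ _, hT.2⟩

end Locality

end TradEq
namespace TradEq

/-! ### Values of a sensitive valuation -/

section Values

variable {m : ℕ} (d : Sensitive m) (S : Finset (Fin m))

theorem Sensitive.clause_value_le {a : Clause m} (ha : a ∈ d.clauses) :
    a.value S ≤ d.valuation S :=
  Clause.value_le_xosValuation d.clauses_finite ha S

theorem Sensitive.clauseM_mem {T : Finset (Fin m)} (hT : T.card = m / 2 + 1) :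
    clauseM T (d.item T) (d.k T) ∈ d.clauses :=
  Sensitive.mem_clauses.2 (Or.inr ⟨T, hT, rfl⟩)

theorem Sensitive.baseClauses_subset : baseClauses m ⊆ d.clauses :=
  fun _ h => Sensitive.mem_clauses.2 (Or.inl h)

theorem Sensitive.le_valuation_of_mem {j : Fin m} (hj : j ∈ S) :
    ((m / 2 : ℕ) : ℝ) - 20 ≤ d.valuation S := by
  have := d.clause_value_le S (d.baseClauses_subset (clauseC_mem_base j))
  rwa [clauseC_value, if_pos hj] at this

theorem Sensitive.card_le_valuation (h : S.card ≤ m / 2) : (S.card : ℝ) ≤ d.valuation S := by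
  obtain ⟨U, hU, -, hUc⟩ := Finset.exists_subsuperset_card_eq (n := m / 2)
      (subset_univ S) h (by simpa using Nat.div_le_self m 2)
  have := d.clause_value_le S (d.baseClauses_subset (clauseA_mem_base hUc))
  rwa [clauseA_value, inter_eq_left.2 hU] at this

theorem Sensitive.valuation_nonneg : 0 ≤ d.valuation S := by
  obtain ⟨U, -, hUc⟩ := Finset.exists_subset_card_eq
    (s := (Finset.univ : Finset (Fin m))) (n := m / 2) (by simpa using Nat.div_le_self m 2)
  have := d.clause_value_le S (d.baseClauses_subset (clauseA_mem_base hUc))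
  rw [clauseA_value] at this
  exact (Nat.cast_nonneg _).trans this

theorem Sensitive.le_valuation_of_subset {T : Finset (Fin m)} (hT : T.card = m / 2 + 1)
    (h : T ⊆ S) : ((m / 2 : ℕ) : ℝ) + 1 / 4 + d.k T ≤ d.valuation S := by
  have := d.clause_value_le S (d.clauseM_mem hT)
  rwa [clauseM_value_of_subset hT (d.item_mem T hT) h] at this

theorem Sensitive.le_valuation_of_card_ge (h : m / 2 + 10 ≤ S.card) :
    ((m / 2 : ℕ) : ℝ) + 1 ≤ d.valuation S := by
  obtain ⟨U, hU, hUc⟩ := Finset.exists_subset_card_eq h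
  have := d.clause_value_le S (d.baseClauses_subset (clauseB_mem_base hUc))
  rwa [clauseB_value_of_subset hUc hU] at this

theorem Sensitive.valuation_le_max (hm : 40 ≤ m) :
    d.valuation S ≤ max (S.card : ℝ) (((m / 2 : ℕ) : ℝ) - 20) := by
  have hh : (20 : ℝ) ≤ ((m / 2 : ℕ) : ℝ) := by
    have : 20 ≤ m / 2 := by omega
    exact_mod_cast this
  have hA (T : Finset (Fin m)) : (clauseA T).value S ≤ S.card := by
    rw [clauseA_value]
    exact_mod_cast card_le_card inter_subset_left
  obtain ⟨a, ha, hv⟩ := exists_value_eq_xosValuation d.clauses_finite d.clauses_nonempty S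
  rw [Sensitive.valuation, ← hv]
  rcases Sensitive.mem_clauses.1 ha with ((⟨j, rfl⟩ | ⟨T, -, rfl⟩) | ⟨T, -, rfl⟩) | ⟨T, hT, rfl⟩
  · rw [clauseC_value]
    refine le_max_of_le_right ?_
    split_ifs <;> linarith
  · exact le_max_of_le_left (hA T)
  · exact le_max_of_le_left ((Clause.value_mono (clauseB_le_clauseA T) S).trans (hA T))
  · exact le_max_of_le_left ((Clause.value_mono
      (clauseM_le_clauseA (d.item_mem T hT) (d.k_lt T hT)) S).trans (hA T))

/-- The clauses that can be maximal on a bundle of more than `m'` items. -/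
theorem Sensitive.maximal_clause_cases (hm : 60 ≤ m) {a : Clause m} (ha : a ∈ d.clauses)
    (hS : m / 2 + 1 ≤ S.card) (hv : a.value S = d.valuation S) :
    (∃ T, T.card = m / 2 + 1 ∧ T ⊆ S ∧ S.card ≤ m / 2 + 9 ∧ a = clauseM T (d.item T) (d.k T)) ∨
      ∃ T, T.card = m / 2 + 10 ∧ T ⊆ S ∧ a = clauseB T := by
  have hh : (30 : ℝ) ≤ ((m / 2 : ℕ) : ℝ) := by
    have : 30 ≤ m / 2 := by omega
    exact_mod_cast this
  obtain ⟨U, hU, hUc⟩ := Finset.exists_subset_card_eq hS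
  have hlow := d.le_valuation_of_subset S hUc hU
  have hk := d.k_pos U hUc
  have hAlow {T : Finset (Fin m)} (h : (S ∩ T).card ≤ m / 2) :
      (clauseA T).value S < d.valuation S := by
    rw [clauseA_value]
    have : ((S ∩ T).card : ℝ) ≤ ((m / 2 : ℕ) : ℝ) := by exact_mod_cast h
    linarith
  rcases Sensitive.mem_clauses.1 ha with ((⟨j, rfl⟩ | ⟨T, hT, rfl⟩) | ⟨T, hT, rfl⟩) | ⟨T, hT, rfl⟩
  · rw [clauseC_value] at hv
    split_ifs at hv <;> linarith
  · exact absurd hv (hAlow ((card_le_card inter_subset_right).trans hT.le)).ne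
  · refine Or.inr ⟨T, hT, ?_, rfl⟩
    by_contra hTS
    have hlt : (S ∩ T).card < T.card := by
      refine card_lt_card (Finset.ssubset_iff_subset_ne.2 ⟨inter_subset_right, fun h => hTS ?_⟩)
      exact inter_eq_right.1 h
    have h9 : ((S ∩ T).card : ℝ) ≤ ((m / 2 : ℕ) : ℝ) + 9 := by
      have : (S ∩ T).card ≤ m / 2 + 9 := by omega
      exact_mod_cast this
    -- If B_T misses an item it loses (m' + 1)/(m' + 10), which is at least 3/4 once m' ≥ 26, and so
    -- falls below every M_U with U ⊆ S.
    have h1 : (((m / 2 : ℕ) : ℝ) + 9) * ((((m / 2 : ℕ) : ℝ) + 1) / (((m / 2 : ℕ) : ℝ) + 10)) ≤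
        ((m / 2 : ℕ) : ℝ) + 1 / 4 := by
      rw [mul_div_assoc', div_le_iff₀ (by positivity)]
      nlinarith
    rw [clauseB_value] at hv
    have := mul_le_mul_of_nonneg_right h9 (@clauseB_ratio_nonneg m)
    linarith
  · refine Or.inl ⟨T, hT, ?_, ?_, rfl⟩
    · by_contra hTS
      have hlt : (S ∩ T).card < T.card := by
        refine card_lt_card (Finset.ssubset_iff_subset_ne.2 ⟨inter_subset_right, fun h => hTS ?_⟩)
        exact inter_eq_right.1 h
      refine absurd hv (lt_of_le_of_lt (Clause.value_mono
        (clauseM_le_clauseA (d.item_mem T hT) (d.k_lt T hT)) S) (hAlow ?_)).ne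
      omega
    · by_contra! hc
      have h1 := d.le_valuation_of_card_ge S hc
      have h2 := clauseM_value_le hT (d.item_mem T hT) (d.k_pos T hT) S
      have h3 := d.k_lt T hT
      linarith

end Values

/-! ### Traditional equilibria with sensitive valuations -/

section Equilibrium

variable {m : ℕ}

theorem IsOutcome.alloc_opponent {b : Fin 2 → Fin m → ℝ} {S : Fin 2 → Finset (Fin m)}
    (h : IsOutcome b S) (i : Fin 2) : S (opponent i) = (S i)ᶜ := by
  obtain ⟨hd, hu, -⟩ := h
  have hc : IsCompl (S 0) (S 1) := ⟨hd, codisjoint_iff.2 hu⟩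
  fin_cases i
  · exact hc.compl_eq.symm
  · exact hc.symm.compl_eq.symm

theorem opponent_ne (i : Fin 2) : opponent i ≠ i := by
  fin_cases i <;> decide

theorem opponent_opponent (i : Fin 2) : opponent (opponent i) = i := by
  fin_cases i <;> decide

theorem eq_or_eq_opponent (i i' : Fin 2) : i' = i ∨ i' = opponent i := by
  fin_cases i <;> fin_cases i' <;> decide

variable {d : Sensitive m} {O : Finset (Fin m) → Clause m} {P : Profile m}

/-- In a traditional equilibrium no bidder gains by additionally taking some items, if all but one
of them are free. -/
theorem IsTraditionalEquilibrium.valuation_sub_le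
    (hP : IsTraditionalEquilibrium (fun _ => d.valuation) (fun _ => O) P) (i : Fin 2)
    {W : Finset (Fin m)} (hW : P.alloc i ⊆ W) {x : Fin m}
    (hfree : ∀ j ∈ W, j ∉ P.alloc i → j ≠ x → P.bid (opponent i) j = 0)
    (hx : P.bid (opponent i) x ≤ ((m / 2 : ℕ) : ℝ) - 20) :
    d.valuation W - P.bid (opponent i) x ≤ d.valuation (P.alloc i) := by
  classical
  obtain ⟨⟨hout, hno, heq⟩, htrad⟩ := hP
  have hopp := hout.alloc_opponent i
  have hbid0 (j : Fin m) (hj : j ∈ P.alloc i) : P.bid (opponent i) j = 0 :=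
    (htrad (opponent i) j).2 (by simpa [hopp] using hj)
  have hnonneg := (hno (opponent i)).1
  have hW0 (j : Fin m) (hj : j ∈ W) (hjx : j ≠ x) : P.bid (opponent i) j = 0 := by
    by_cases h : j ∈ P.alloc i
    · exact hbid0 j h
    · exact hfree j hj h hjx
  -- The deviation matches the opponent's bid on x and bids 0 elsewhere; the ties are resolved so
  -- that exactly W is won. The clause C_x makes this admissible, which is why the price of x is
  -- bounded by m' - 20.
  let b' : Fin m → ℝ := fun j => if j = x then P.bid (opponent i) x else 0
  let S' : Fin 2 → Finset (Fin m) := fun i' => if i' = i then W else Wᶜ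
  have hSi : S' i = W := if_pos rfl
  have hSo : S' (opponent i) = Wᶜ := if_neg (opponent_ne i)
  have hb' : IsNoOverbidding d.valuation b' := by
    refine ⟨fun j => ?_, fun S => ?_⟩
    · simp only [b']
      split_ifs
      exacts [hnonneg x, le_rfl]
    · simp only [b', Finset.sum_ite_eq']
      split_ifs with h
      · exact hx.trans (d.le_valuation_of_mem S h)
      · exact d.valuation_nonneg S
  have hui : Function.update P.bid i b' i = b' := Function.update_self ..
  have huo : Function.update P.bid i b' (opponent i) = P.bid (opponent i) :=
    Function.update_of_ne (opponent_ne i) ..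
  have hout' : IsOutcome (Function.update P.bid i b') S' := by
    refine ⟨?_, ?_, fun i' j hj => ?_⟩
    · rcases eq_or_eq_opponent i 0 with h | h <;> rcases eq_or_eq_opponent i 1 with h' | h'
      · exact absurd (h.trans h'.symm) (by decide)
      · rw [h', h, hSi, hSo]; exact disjoint_compl_right
      · rw [h', h, hSi, hSo]; exact disjoint_compl_left
      · exact absurd (h.trans h'.symm) (by decide)
    · rcases eq_or_eq_opponent i 0 with h | h <;> rcases eq_or_eq_opponent i 1 with h' | h'
      · exact absurd (h.trans h'.symm) (by decide)
      · rw [h', h, hSi, hSo]; exact union_compl W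
      · rw [h', h, hSi, hSo]; rw [union_comm]; exact union_compl W
      · exact absurd (h.trans h'.symm) (by decide)
    · rcases eq_or_eq_opponent i i' with rfl | rfl
      · rw [hui, huo]
        rw [hSi] at hj
        by_cases h : j = x
        · simp [b', h]
        · simp [b', h, hW0 j hj h]
      · rw [opponent_opponent, hui, huo]
        by_cases h : j = x
        · simp [b', h]
        · simpa [b', h] using hnonneg j
  have key := heq i b' hb' S' hout'
  have h1 : ∑ j ∈ P.alloc i, P.bid (opponent i) j = 0 := Finset.sum_eq_zero hbid0
  have h2 : ∑ j ∈ W, P.bid (opponent i) j ≤ P.bid (opponent i) x := by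
    by_cases h : x ∈ W
    · rw [Finset.sum_eq_single_of_mem x h hW0]
    · rw [Finset.sum_eq_zero fun j hj => hW0 j hj fun e => h (e ▸ hj)]
      exact hnonneg x
  simp only [utility, huo, hSi, h1] at key
  linarith

/-- A traditional equilibrium contains a local maximum of the parameters `k`. -/
theorem IsTraditionalEquilibrium.exists_local_max (hm : Odd m) (hm' : 60 ≤ m)
    (hO : IsXOSOracle d.clauses O)
    (hP : IsTraditionalEquilibrium (fun _ => d.valuation) (fun _ => O) P) :
    ∃ i, (P.alloc i).card = m / 2 + 1 ∧
      d.k (insert (d.item (P.alloc i)) (P.alloc i)ᶜ) ≤ d.k (P.alloc i) := by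
  have h2m : m = 2 * (m / 2) + 1 := by obtain ⟨k, rfl⟩ := hm; omega
  have hh : (30 : ℝ) ≤ ((m / 2 : ℕ) : ℝ) := by
    have : 30 ≤ m / 2 := by omega
    exact_mod_cast this
  have hcard (i : Fin 2) : (P.alloc i).card + (P.alloc (opponent i)).card = m := by
    rw [hP.1.1.alloc_opponent i, card_add_card_compl, Fintype.card_fin]
  obtain ⟨i, hi⟩ : ∃ i, (P.alloc i).card ≤ m / 2 := by
    by_contra! h
    have h0 := h 0
    have h1 := h (opponent 0)
    have := hcard 0
    omega
  have hci := hcard i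
  have hopp := hP.1.1.alloc_opponent i
  have hbid (j : Fin m) (hj : j ∈ P.alloc (opponent i)) :
      P.bid (opponent i) j = O (P.alloc (opponent i)) j := (hP.2 (opponent i) j).1 hj
  have hmax := d.valuation_le_max (P.alloc i) (by omega)
  set S := P.alloc (opponent i) with hS
  have hiS : P.alloc i = Sᶜ := by rw [hopp, compl_compl]
  rcases d.maximal_clause_cases S hm' (hO S).1 (by omega) (hO S).2 with
    ⟨T, hT, hTS, hS9, ha⟩ | ⟨T, hT, hTS, ha⟩
  · rcases (card_le_card hTS).eq_or_lt with hc | hc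
    · obtain rfl := eq_of_subset_of_card_le hTS hc.ge
      refine ⟨opponent i, by rw [← hS]; exact hT, ?_⟩
      rw [← hS]
      have hj := d.item_mem S hT
      have hjc : d.item S ∉ Sᶜ := by simpa using hj
      have hp : P.bid (opponent i) (d.item S) = 1 / 4 + d.k S := by
        rw [hbid _ hj, ha]
        simp [clauseM]
      have hk := d.k_lt S hT
      have hWc : (insert (d.item S) Sᶜ).card = m / 2 + 1 := by
        rw [card_insert_of_notMem hjc, card_compl, Fintype.card_fin]
        omega
      have h1 := hP.valuation_sub_le i (W := insert (d.item S) Sᶜ) (x := d.item S)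
        (by rw [hiS]; exact subset_insert _ _)
        (fun j hj hji hjx => by
          rw [hiS] at hji
          exact absurd ((mem_insert.1 hj).resolve_left hjx) hji)
        (by rw [hp]; linarith)
      have h2 := d.le_valuation_of_subset _ hWc subset_rfl
      have h3 : ((P.alloc i).card : ℝ) ≤ ((m / 2 : ℕ) : ℝ) := by exact_mod_cast hi
      have h4 := hmax.trans (max_le h3 (by linarith))
      rw [hp] at h1
      linarith
    · exfalso
      -- An item of S outside T is free. Since |S| ≤ m' + 9, the smaller bidder holds at least m' -
      -- 9 items, so his value is at most their number, and one more item raises it.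
      obtain ⟨x, hxS, hxT⟩ := Finset.exists_mem_notMem_of_card_lt_card hc
      have hp : P.bid (opponent i) x = 0 := by
        rw [hbid _ hxS, ha]
        have : x ≠ d.item T := fun e => hxT (e ▸ d.item_mem T hT)
        simp [clauseM, this, hxT]
      have hxi : x ∉ P.alloc i := by simpa [hiS] using hxS
      have hWc : (insert x (P.alloc i)).card = (P.alloc i).card + 1 := card_insert_of_notMem hxi
      have h1 := hP.valuation_sub_le i (W := insert x (P.alloc i)) (x := x) (subset_insert _ _)
        (fun j hj hji hjx => absurd ((mem_insert.1 hj).resolve_left hjx) hji)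
        (by rw [hp]; linarith)
      have h2 := d.card_le_valuation (insert x (P.alloc i)) (by omega)
      have h3 : ((m / 2 : ℕ) : ℝ) - 20 ≤ ((P.alloc i).card : ℝ) := by
        have : m / 2 ≤ (P.alloc i).card + 20 := by omega
        have : ((m / 2 : ℕ) : ℝ) ≤ ((P.alloc i).card : ℝ) + 20 := by exact_mod_cast this
        linarith
      rw [max_eq_left h3] at hmax
      rw [hWc] at h2
      push_cast at h2
      linarith
  · exfalso
    -- Everything outside T is free and x ∈ T costs less than 1. Taking Tᶜ ∪ {x} secures m' - 8,
    -- while the current value is at most |Tᶜ| = m' - 9.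
    obtain ⟨x, hxT⟩ : T.Nonempty := card_pos.1 (by omega)
    have hp : P.bid (opponent i) x < 1 := by
      rw [hbid _ (hTS hxT), ha, clauseB, if_pos hxT]
      exact clauseB_ratio_lt_one
    have hsub : P.alloc i ⊆ Tᶜ := by rw [hiS]; exact compl_subset_compl.2 hTS
    have hTc : Tᶜ.card + 9 = m / 2 := by
      rw [card_compl, Fintype.card_fin]
      omega
    have hWc : (insert x Tᶜ).card = Tᶜ.card + 1 := card_insert_of_notMem (by simpa using hxT)
    have h1 := hP.valuation_sub_le i (W := insert x Tᶜ) (x := x) (hsub.trans (subset_insert _ _))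
      (fun j hj hji hjx => by
        have hjT := (mem_insert.1 hj).resolve_left hjx
        rw [mem_compl] at hjT
        rw [hbid j (by simpa [hiS] using hji), ha, clauseB, if_neg hjT])
      (by linarith)
    have h2 := d.card_le_valuation (insert x Tᶜ) (by omega)
    have h3 : ((P.alloc i).card : ℝ) ≤ (Tᶜ.card : ℝ) := by exact_mod_cast card_le_card hsub
    have h4 : (Tᶜ.card : ℝ) + 9 = ((m / 2 : ℕ) : ℝ) := by exact_mod_cast hTc
    have h5 := hmax.trans (max_le h3 (by linarith))
    rw [hWc] at h2
    push_cast at h2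
    linarith

end Equilibrium

end TradEq
namespace TradEq

/-! ### The odd graph -/

section OddGraph

variable {m : ℕ}

/-- The bundles of size `m' + 1` form the odd graph: `S` is adjacent to `Sᶜ ∪ {j}` for `j ∈ S`. -/
def OddAdj (S T : Finset (Fin m)) : Prop := ∃ j ∈ S, T = insert j Sᶜ

/-- There is a path from `S` to `T` in the odd graph that stays in `C`. -/
abbrev ReachIn (C : Set (Finset (Fin m))) : Finset (Fin m) → Finset (Fin m) → Prop :=
  Relation.ReflTransGen fun S T => T ∈ C ∧ OddAdj S T

theorem ReachIn.mono {C C' : Set (Finset (Fin m))} (h : C ⊆ C') {S T : Finset (Fin m)}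
    (hST : ReachIn C S T) : ReachIn C' S T :=
  Relation.ReflTransGen.mono (fun _ _ h' => ⟨h h'.1, h'.2⟩) _ _ hST

variable (z : Fin m) (G : Finset (Fin m))

/-- The part of a bundle, or of its complement, in `G`. -/
def label (S : Finset (Fin m)) : Finset (Fin m) := if z ∈ S then G ∩ S else G \ S

/-- The bundles of size `m' + 1` with a given label. -/
def line (a : Finset (Fin m)) : Set (Finset (Fin m)) :=
  {S | S.card = m / 2 + 1 ∧ label z G S = a}

variable {z G} {a : Finset (Fin m)}

theorem mem_line {S : Finset (Fin m)} :
    S ∈ line z G a ↔ S.card = m / 2 + 1 ∧ label z G S = a := Iff.rfl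

theorem card_insert_compl (hm : Odd m) {S : Finset (Fin m)} (hS : S.card = m / 2 + 1)
    {j : Fin m} (hj : j ∈ S) : (insert j Sᶜ).card = m / 2 + 1 := by
  rw [card_insert_of_notMem (by simpa using hj), card_compl, Fintype.card_fin]
  obtain ⟨k, rfl⟩ := hm
  omega

/-- Complementation flips the membership of z and of every item of G simultaneously. The case
distinction on z in `label` cancels this, as long as the item put back is neither z nor in G. -/
theorem insert_compl_mem_line (hm : Odd m) {S : Finset (Fin m)} (hS : S ∈ line z G a)
    {j : Fin m} (hj : j ∈ S) (hjG : j ∉ G) (hjz : j ≠ z) : insert j Sᶜ ∈ line z G a := by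
  refine ⟨card_insert_compl hm hS.1 hj, ?_⟩
  rw [← (mem_line.1 hS).2]
  by_cases hz : z ∈ S
  · have hz' : z ∉ insert j Sᶜ := by simp [hz, hjz.symm]
    rw [label, label, if_pos hz, if_neg hz']
    ext x
    simp only [mem_sdiff, mem_insert, mem_compl, mem_inter]
    grind
  · have hz' : z ∈ insert j Sᶜ := by simp [hz]
    rw [label, label, if_neg hz, if_pos hz']
    ext x
    simp only [mem_sdiff, mem_insert, mem_compl, mem_inter]
    grind

/-- Two steps of the odd graph, with j ∈ S \ T and then i ∈ T \ S, replace j by i in S. The labels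
agree, so neither item is in G, and both steps stay on the line. -/
theorem reachIn_line_of_mem (hm : Odd m) {S T : Finset (Fin m)} (hS : S ∈ line z G a)
    (hT : T ∈ line z G a) (hzS : z ∈ S) (hzT : z ∈ T) : ReachIn (line z G a) S T := by
  obtain ⟨n, hn⟩ : ∃ n, (S \ T).card = n := ⟨_, rfl⟩
  induction n generalizing S with
  | zero =>
    have : S ⊆ T := by rwa [card_eq_zero, sdiff_eq_empty_iff_subset] at hn
    rw [eq_of_subset_of_card_le this (by rw [hS.1, hT.1])]
  | succ n ih =>
    obtain ⟨j, hj⟩ : (S \ T).Nonempty := card_pos.1 (by omega)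
    obtain ⟨i, hi⟩ : (T \ S).Nonempty := by
      have h1 := card_sdiff_add_card_inter S T
      have h2 := card_sdiff_add_card_inter T S
      rw [inter_comm T S] at h2
      have := hS.1
      have := hT.1
      exact card_pos.1 (by omega)
    rw [mem_sdiff] at hi hj
    have hl : G ∩ S = G ∩ T := by
      have h1 := (mem_line.1 hS).2
      have h2 := (mem_line.1 hT).2
      rw [label, if_pos hzS] at h1
      rw [label, if_pos hzT] at h2
      exact h1.trans h2.symm
    have hjG : j ∉ G := fun h => hj.2 (mem_inter.1 (hl ▸ mem_inter.2 ⟨h, hj.1⟩)).2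
    have hiG : i ∉ G := fun h => hi.2 (mem_inter.1 (hl.symm ▸ mem_inter.2 ⟨h, hi.1⟩)).2
    have hjz : j ≠ z := fun h => hj.2 (h ▸ hzT)
    have hiz : i ≠ z := fun h => hi.2 (h ▸ hzS)
    have hU := insert_compl_mem_line hm hS hj.1 hjG hjz
    have hiU : i ∈ insert j Sᶜ := by simp [hi.2]
    have hV := insert_compl_mem_line hm hU hiU hiG hiz
    have hVT : insert i (insert j Sᶜ)ᶜ \ T = (S \ T).erase j := by
      ext x
      simp only [mem_sdiff, mem_insert, mem_compl, mem_erase]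
      grind
    refine Relation.ReflTransGen.head ⟨hU, j, hj.1, rfl⟩
      (Relation.ReflTransGen.head ⟨hV, i, hiU, rfl⟩ (ih hV ?_ ?_))
    · simp only [mem_insert, mem_compl]
      grind
    · rw [hVT, card_erase_of_mem (mem_sdiff.2 hj), hn, Nat.add_sub_cancel]

theorem reachIn_line (hm : Odd m) (hG : G.card ≤ m / 2) {S T : Finset (Fin m)}
    (hS : S ∈ line z G a) (hT : T ∈ line z G a) (hzT : z ∈ T) : ReachIn (line z G a) S T := by
  by_cases hzS : z ∈ S
  · exact reachIn_line_of_mem hm hS hT hzS hzT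
  -- One step moves to a bundle containing z; the bound on |G| provides an item of S for it outside
  -- G.
  · obtain ⟨j, hjS, hjG⟩ := Finset.exists_mem_notMem_of_card_lt_card
      (show G.card < S.card by rw [hS.1]; omega)
    have hU := insert_compl_mem_line hm hS hjS hjG fun h => hzS (h ▸ hjS)
    exact Relation.ReflTransGen.head ⟨hU, j, hjS, rfl⟩
      (reachIn_line_of_mem hm hU hT (by simp [hzS]) hzT)

/-- The labels of size `r` that do not occur in `Q`. -/
def freeLabels (z : Fin m) (G : Finset (Fin m)) (r : ℕ) (Q : Finset (Finset (Fin m))) :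
    Finset (Finset (Fin m)) := powersetCard r G \ Q.image (label z G)

theorem freeLabels_nonempty {r : ℕ} {Q : Finset (Finset (Fin m))} (h : Q.card < G.card.choose r) :
    (freeLabels z G r Q).Nonempty := by
  obtain ⟨b, hb, hb'⟩ := Finset.exists_mem_notMem_of_card_lt_card
    (s := Q.image (label z G)) (t := powersetCard r G)
    (by rw [card_powersetCard]; exact card_image_le.trans_lt h)
  exact ⟨b, mem_sdiff.2 ⟨hb, hb'⟩⟩

theorem freeLabels_anti {r : ℕ} {Q Q' : Finset (Finset (Fin m))} (h : Q ⊆ Q') :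
    freeLabels z G r Q' ⊆ freeLabels z G r Q :=
  sdiff_subset_sdiff subset_rfl (image_subset_image h)

theorem notMem_line_of_mem_freeLabels {r : ℕ} {Q : Finset (Finset (Fin m))} {S : Finset (Fin m)}
    (hS : S ∈ Q) (ha : a ∈ freeLabels z G r Q) : S ∉ line z G a := fun h =>
  (mem_sdiff.1 ha).2 (mem_image.2 ⟨S, hS, h.2⟩)

/-- A partition of the items into one item and two sets of `m'` items. -/
structure Splitting (m : ℕ) where
  z : Fin m
  G₁ : Finset (Fin m)
  G₂ : Finset (Fin m)
  notMem₁ : z ∉ G₁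
  notMem₂ : z ∉ G₂
  disj : Disjoint G₁ G₂
  card₁ : G₁.card = m / 2
  card₂ : G₂.card = m / 2

theorem Splitting.exists (hm : Odd m) : Nonempty (Splitting m) := by
  obtain ⟨k, rfl⟩ := hm
  have hk : (2 * k + 1) / 2 = k := by omega
  let z : Fin (2 * k + 1) := 0
  have hz : (univ.erase z).card = 2 * k := by simp
  obtain ⟨G, hG, hGc⟩ := Finset.exists_subset_card_eq (s := univ.erase z) (n := k) (by omega)
  refine ⟨⟨z, G, univ.erase z \ G, fun h => notMem_erase z _ (hG h), ?_, disjoint_sdiff, ?_, ?_⟩⟩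
  · simp
  · omega
  · rw [card_sdiff_of_subset hG]
    omega

/-- The union of the lines that do not meet `Q`. -/
def Splitting.live (s : Splitting m) (Q : Finset (Finset (Fin m))) : Set (Finset (Fin m)) :=
  {S | (∃ a ∈ freeLabels s.z s.G₁ (m / 2 / 2) Q, S ∈ line s.z s.G₁ a) ∨
    ∃ b ∈ freeLabels s.z s.G₂ (m / 2 - m / 2 / 2) Q, S ∈ line s.z s.G₂ b}

variable {s : Splitting m} {Q Q' : Finset (Finset (Fin m))}

theorem Splitting.card_of_mem_live {S : Finset (Fin m)} (h : S ∈ s.live Q) :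
    S.card = m / 2 + 1 := by
  rcases h with ⟨a, -, h⟩ | ⟨a, -, h⟩ <;> exact h.1

theorem Splitting.live_anti (h : Q ⊆ Q') : s.live Q' ⊆ s.live Q := by
  rintro S (⟨a, ha, hS⟩ | ⟨a, ha, hS⟩)
  · exact Or.inl ⟨a, freeLabels_anti h ha, hS⟩
  · exact Or.inr ⟨a, freeLabels_anti h ha, hS⟩

theorem Splitting.notMem_live {S : Finset (Fin m)} (h : S ∈ Q) : S ∉ s.live Q := by
  rintro (⟨a, ha, hS⟩ | ⟨a, ha, hS⟩) <;> exact notMem_line_of_mem_freeLabels h ha hS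

/-- The crossing points of the grid. The two label sizes add up to m', so that with z the bundle has
exactly m' + 1 items. -/
theorem Splitting.hub_mem (s : Splitting m) {a b : Finset (Fin m)}
    (ha : a ∈ powersetCard (m / 2 / 2) s.G₁) (hb : b ∈ powersetCard (m / 2 - m / 2 / 2) s.G₂) :
    insert s.z (a ∪ b) ∈ line s.z s.G₁ a ∧ insert s.z (a ∪ b) ∈ line s.z s.G₂ b := by
  rw [mem_powersetCard] at ha hb
  have hab : Disjoint a b := disjoint_of_subset_left ha.1 (disjoint_of_subset_right hb.1 s.disj)
  have h1 := s.notMem₁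
  have h2 := s.notMem₂
  have hd := Finset.disjoint_left.1 s.disj
  have hc : (insert s.z (a ∪ b)).card = m / 2 + 1 := by
    rw [card_insert_of_notMem, card_union_of_disjoint hab]
    · omega
    · rw [mem_union]
      exact fun h => h.elim (fun h => h1 (ha.1 h)) fun h => h2 (hb.1 h)
  refine ⟨⟨hc, ?_⟩, hc, ?_⟩ <;> rw [label, if_pos (mem_insert_self _ _)] <;> ext x <;>
    simp only [mem_inter, mem_insert, mem_union]
  · have := @ha.1 x
    have := @hb.1 x
    have := @hd x
    grind
  · have := @ha.1 x
    have := @hb.1 x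
    have := @hd x
    grind

/-- From every live bundle one can reach every intersection of free lines. -/
theorem Splitting.reachIn_live (hm : Odd m) {S a b : Finset (Fin m)} (hS : S ∈ s.live Q)
    (ha : a ∈ freeLabels s.z s.G₁ (m / 2 / 2) Q)
    (hb : b ∈ freeLabels s.z s.G₂ (m / 2 - m / 2 / 2) Q) :
    ReachIn (s.live Q) S (insert s.z (a ∪ b)) := by
  have h1 {c : Finset (Fin m)} (hc : c ∈ freeLabels s.z s.G₁ (m / 2 / 2) Q) :
      line s.z s.G₁ c ⊆ s.live Q := fun S hS => Or.inl ⟨c, hc, hS⟩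
  have h2 {c : Finset (Fin m)} (hc : c ∈ freeLabels s.z s.G₂ (m / 2 - m / 2 / 2) Q) :
      line s.z s.G₂ c ⊆ s.live Q := fun S hS => Or.inr ⟨c, hc, hS⟩
  have ha' := (mem_sdiff.1 ha).1
  have hb' := (mem_sdiff.1 hb).1
  rcases hS with ⟨c, hc, hS⟩ | ⟨c, hc, hS⟩
  · have hc' := (mem_sdiff.1 hc).1
    exact ((reachIn_line hm s.card₁.le hS (s.hub_mem hc' hb').1 (mem_insert_self _ _)).mono
      (h1 hc)).trans ((reachIn_line hm s.card₂.le (s.hub_mem hc' hb').2 (s.hub_mem ha' hb').2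
        (mem_insert_self _ _)).mono (h2 hb))
  · have hc' := (mem_sdiff.1 hc).1
    exact ((reachIn_line hm s.card₂.le hS (s.hub_mem ha' hc').2 (mem_insert_self _ _)).mono
      (h2 hc)).trans ((reachIn_line hm s.card₁.le (s.hub_mem ha' hc').1 (s.hub_mem ha' hb').1
        (mem_insert_self _ _)).mono (h1 ha))

/-- As long as `Q` is small, there is a bundle in `live Q` that can be reached from every bundle
in `live Q₀` for `Q₀ ⊆ Q`. -/
theorem Splitting.exists_reachIn (hm : Odd m) (hQ : Q.card < (m / 2).choose (m / 2 / 2)) :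
    ∃ T ∈ s.live Q, s.z ∈ T ∧ ∀ Q₀ ⊆ Q, ∀ S ∈ s.live Q₀, ReachIn (s.live Q₀) S T := by
  obtain ⟨a, ha⟩ : (freeLabels s.z s.G₁ (m / 2 / 2) Q).Nonempty :=
    freeLabels_nonempty (by rwa [s.card₁])
  obtain ⟨b, hb⟩ : (freeLabels s.z s.G₂ (m / 2 - m / 2 / 2) Q).Nonempty :=
    freeLabels_nonempty (by rwa [s.card₂, Nat.choose_symm (Nat.div_le_self _ _)])
  exact ⟨_, Or.inl ⟨a, ha, (s.hub_mem (mem_sdiff.1 ha).1 (mem_sdiff.1 hb).1).1⟩,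
    mem_insert_self _ _, fun Q₀ h S hS =>
      s.reachIn_live hm hS (freeLabels_anti h ha) (freeLabels_anti h hb)⟩

/-- The odd graph is connected. -/
theorem reachIn_card (hm : Odd m) {S T : Finset (Fin m)} (hS : S.card = m / 2 + 1)
    (hT : T.card = m / 2 + 1) {z : Fin m} (hz : z ∈ T) :
    ReachIn {S | S.card = m / 2 + 1} S T := by
  -- For G = ∅ a single line comprises all bundles of size m' + 1.
  have h (U : Finset (Fin m)) : label z ∅ U = ∅ := by simp [label]
  exact (reachIn_line hm (z := z) (G := ∅) (a := ∅) (by simp) ⟨hS, h S⟩ ⟨hT, h T⟩ hz).mono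
    fun U hU => hU.1

end OddGraph

/-! ### The adversary -/

section Adversary

variable {m : ℕ}

/-- A function that decreases towards `C'` along the edges of the odd graph inside `C`. -/
theorem exists_potential {C C' : Set (Finset (Fin m))}
    (h : ∀ S ∈ C, ∃ T ∈ C', ReachIn C S T) :
    ∃ δ : Finset (Fin m) → ℕ, ∀ S ∈ C, S ∉ C' → ∃ T ∈ C, OddAdj S T ∧ δ T < δ S := by
  classical
  -- `P n S` says that a walk of n steps inside C leads from S to C'. The potential is the least
  -- such n; its default 0 is never used on C.
  let P : ℕ → Finset (Fin m) → Prop := fun n =>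
    Nat.rec (motive := fun _ => Finset (Fin m) → Prop) (fun S => S ∈ C')
      (fun _ ih S => ∃ T ∈ C, OddAdj S T ∧ ih T) n
  have hP : ∀ S ∈ C, ∃ n, P n S := by
    intro S hS
    obtain ⟨T, hT, hr⟩ := h S hS
    induction hr using Relation.ReflTransGen.head_induction_on with
    | refl => exact ⟨0, hT⟩
    | head hab _ ih =>
      obtain ⟨n, hn⟩ := ih hab.1
      exact ⟨n + 1, _, hab.1, hab.2, hn⟩
  refine ⟨fun S : Finset (Fin m) => if h' : ∃ n, P n S then Nat.find h' else 0, fun S hS hS' => ?_⟩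
  have hf := Nat.find_spec (hP S hS)
  obtain ⟨n, hn⟩ : ∃ n, Nat.find (hP S hS) = n := ⟨_, rfl⟩
  rw [hn] at hf
  cases n with
  | zero => exact absurd hf hS'
  | succ n =>
    obtain ⟨T, hT, hST, hTn⟩ := hf
    refine ⟨T, hT, hST, ?_⟩
    simp only [dif_pos (hP S hS), dif_pos (hP T hT), hn]
    exact Nat.lt_succ_of_le (Nat.find_min' _ hTn)

/-- Parameters of a sensitive valuation, with natural numbers instead of the numbers `k_S`. -/
structure Ranking (m : ℕ) where
  rank : Finset (Fin m) → ℕ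
  item : Finset (Fin m) → Fin m
  item_mem : ∀ S, S.card = m / 2 + 1 → item S ∈ S

/-- An order embedding of the natural numbers into `(0, 1/4)`. -/
noncomputable def rankValue (n : ℕ) : ℝ := 1 / 4 - 1 / ((n : ℝ) + 5)

theorem rankValue_strictMono : StrictMono rankValue := by
  intro a b h
  have : (a : ℝ) < b := by exact_mod_cast h
  have := one_div_lt_one_div_of_lt (show (0 : ℝ) < (a : ℝ) + 5 by positivity)
    (show (a : ℝ) + 5 < (b : ℝ) + 5 by linarith)
  unfold rankValue
  linarith

theorem rankValue_pos (n : ℕ) : 0 < rankValue n := by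
  refine lt_of_lt_of_le ?_ (rankValue_strictMono.monotone (Nat.zero_le n))
  norm_num [rankValue]

theorem rankValue_lt (n : ℕ) : rankValue n < 1 / 4 := by
  have : 0 < 1 / ((n : ℝ) + 5) := by positivity
  unfold rankValue
  linarith

namespace Ranking

/-- The sensitive valuation given by a ranking. -/
noncomputable def toSensitive (r : Ranking m) : Sensitive m where
  k S := rankValue (r.rank S)
  item := r.item
  k_pos _ _ := rankValue_pos _
  k_lt _ _ := rankValue_lt _
  item_mem := r.item_mem

/-- The neighbor that determines whether `S` can belong to an equilibrium. -/
def next (r : Ranking m) (S : Finset (Fin m)) : Finset (Fin m) := insert (r.item S) Sᶜ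

/-- Outside `C` there are no local maxima, and the ranks are smaller than in `C`, where the rank
is constant. -/
def Climbs (r : Ranking m) (C : Set (Finset (Fin m))) : Prop :=
  ∃ B, (∀ S ∈ C, r.rank S = B) ∧
    ∀ S, S.card = m / 2 + 1 → S ∉ C → r.rank S < B ∧ r.rank S < r.rank (r.next S)

/-- The two rankings agree outside `C`. -/
def AgreeOff (r r' : Ranking m) (C : Set (Finset (Fin m))) : Prop :=
  ∀ S ∉ C, r'.rank S = r.rank S ∧ r'.item S = r.item S

theorem AgreeOff.trans {r r' r'' : Ranking m} {C C' : Set (Finset (Fin m))} (hC : C' ⊆ C)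
    (h : r.AgreeOff r' C) (h' : r'.AgreeOff r'' C') : r.AgreeOff r'' C := fun S hS => by
  have h1 := h S hS
  have h2 := h' S fun hS' => hS (hC hS')
  exact ⟨h2.1.trans h1.1, h2.2.trans h1.2⟩

/-- Bundles leaving C point to a neighbor in C closer to C', with ranks that grow as the distance to
C' shrinks. No rank in C drops below the old constant B, so bundles that were already dead and point
into C still climb. -/
theorem Climbs.exists_shrink {r : Ranking m} {C C' : Set (Finset (Fin m))} (hr : r.Climbs C)
    (hsub : C' ⊆ C)
    (hreach : ∀ S ∈ C, ∃ T ∈ C', ReachIn C S T) :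
    ∃ r' : Ranking m, r'.Climbs C' ∧ r.AgreeOff r' C := by
  classical
  obtain ⟨B, hB, hdead⟩ := hr
  obtain ⟨δ, hδ⟩ := exists_potential hreach
  obtain ⟨N, hN⟩ : ∃ N, ∀ S, δ S ≤ N := by
    obtain ⟨N, hN⟩ := (Set.finite_range δ).bddAbove
    exact ⟨N, fun S => hN ⟨S, rfl⟩⟩
  have hj : ∀ S, ∃ j, (S ∈ C → S ∉ C' → j ∈ S ∧ insert j Sᶜ ∈ C ∧ δ (insert j Sᶜ) < δ S) ∧
      (¬ (S ∈ C ∧ S ∉ C') → j = r.item S) := by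
    intro S
    by_cases hS : S ∈ C ∧ S ∉ C'
    · obtain ⟨T, hT, ⟨j, hj, rfl⟩, hlt⟩ := hδ S hS.1 hS.2
      exact ⟨j, fun _ _ => ⟨hj, hT, hlt⟩, fun h => absurd hS h⟩
    · exact ⟨r.item S, fun h h' => absurd ⟨h, h'⟩ hS, fun _ => rfl⟩
  choose f hf hf' using hj
  -- As δ ≤ N, the subtraction is never truncated and the middle ranks lie between B and B + N,
  -- strictly below those on C'.
  let ρ : Finset (Fin m) → ℕ := fun S =>
    if S ∈ C' then B + N + 1 else if S ∈ C then B + N - δ S else r.rank S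
  have hρ1 {S} (h : S ∈ C') : ρ S = B + N + 1 := if_pos h
  have hρ2 {S} (h : S ∈ C) (h' : S ∉ C') : ρ S = B + N - δ S := by simp [ρ, h, h']
  have hρ3 {S} (h : S ∉ C) : ρ S = r.rank S := by
    have h' : S ∉ C' := fun hS => h (hsub hS)
    simp [ρ, h, h']
  have hρC {S} (h : S ∈ C) : B ≤ ρ S := by
    have := hN S
    by_cases h' : S ∈ C'
    · rw [hρ1 h']; omega
    · rw [hρ2 h h']; omega
  refine ⟨⟨ρ, f, fun S hS => ?_⟩, ⟨B + N + 1, fun S hS => hρ1 hS, fun S hSc hS => ?_⟩,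
    fun S hS => ⟨hρ3 hS, hf' S fun h => hS h.1⟩⟩
  · by_cases h : S ∈ C ∧ S ∉ C'
    · exact (hf S h.1 h.2).1
    · rw [hf' S h]
      exact r.item_mem S hS
  · change ρ S < B + N + 1 ∧ ρ S < ρ (insert (f S) Sᶜ)
    by_cases hSC : S ∈ C
    · obtain ⟨-, hT, hlt⟩ := hf S hSC hS
      rw [hρ2 hSC hS]
      refine ⟨by omega, ?_⟩
      have := hN S
      by_cases hT' : insert (f S) Sᶜ ∈ C'
      · rw [hρ1 hT']; omega
      · rw [hρ2 hT hT']; omega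
    · obtain ⟨h1, h2⟩ := hdead S hSc hSC
      rw [hρ3 hSC, hf' S fun h => hSC h.1]
      refine ⟨by omega, ?_⟩
      by_cases hT : r.next S ∈ C
      · exact h1.trans_le (hρC hT)
      · exact h2.trans_eq (hρ3 hT).symm

theorem Climbs.exists_query {s : Splitting m} {Q : Finset (Finset (Fin m))} {r : Ranking m}
    (hm : Odd m) (hr : r.Climbs (s.live Q)) (R : Finset (Finset (Fin m)))
    (hQ : Q.card + R.card < (m / 2).choose (m / 2 / 2)) :
    ∃ r' : Ranking m, r'.Climbs (s.live (Q ∪ R)) ∧ r.AgreeOff r' (s.live Q) := by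
  obtain ⟨T, hT, -, h⟩ := Splitting.exists_reachIn (s := s) (Q := Q ∪ R) hm
    ((card_union_le _ _).trans_lt hQ)
  exact hr.exists_shrink (Splitting.live_anti subset_union_left)
    fun S hS => ⟨T, hT, h Q subset_union_left S hS⟩

/-- Initially all bundles of size m' + 1 are free with rank 0. Those on no line of the grid are then
made to climb towards it, since the odd graph is connected. -/
theorem exists_climbs_live_empty (hm : Odd m) (s : Splitting m) :
    ∃ r : Ranking m, r.Climbs (s.live ∅) := by
  have hne (S : Finset (Fin m)) : ∃ j, S.card = m / 2 + 1 → j ∈ S := by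
    by_cases h : S.Nonempty
    · exact ⟨h.choose, fun _ => h.choose_spec⟩
    · rw [not_nonempty_iff_eq_empty] at h
      exact ⟨s.z, fun hc => by simp [h] at hc⟩
  choose f hf using hne
  have h0 : (⟨fun _ => 0, f, hf⟩ : Ranking m).Climbs {S | S.card = m / 2 + 1} :=
    ⟨0, fun _ _ => rfl, fun S hS hS' => absurd hS hS'⟩
  obtain ⟨T, hT, hz, -⟩ := Splitting.exists_reachIn (s := s) (Q := ∅) hm
    (by simpa using Nat.choose_pos (Nat.div_le_self (m / 2) 2))
  obtain ⟨r, hr, -⟩ := h0.exists_shrink (fun S => Splitting.card_of_mem_live)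
    fun S hS => ⟨T, hT, reachIn_card hm hS (Splitting.card_of_mem_live hT) hz⟩
  exact ⟨r, hr⟩

open Classical in
/-- The adversary forces every algorithm to make more than `t` queries or to output an allocation
without a local maximum. -/
theorem Climbs.exists_adversary (hm : Odd m) (hm' : 60 ≤ m) (s : Splitting m)
    (τ : Fin 2 → TieBreaking m) (A : Algorithm m) :
    ∀ (t : ℕ) (Q : Finset (Finset (Fin m))) (r : Ranking m),
      Q.card + t * (m + 1) ^ 400 + 2 < (m / 2).choose (m / 2 / 2) → r.Climbs (s.live Q) →
      ∃ r' : Ranking m, r.AgreeOff r' (s.live Q) ∧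
        (t < A.queryCount (r'.toSensitive.answer τ) ∨
          ∀ i, ((A.run (r'.toSensitive.answer τ)).alloc i).card = m / 2 + 1 →
            r'.rank ((A.run (r'.toSensitive.answer τ)).alloc i) <
              r'.rank (r'.next ((A.run (r'.toSensitive.answer τ)).alloc i))) := by
  induction A with
  | output P =>
    intro t Q r hQ hr
    have h2 : ({P.alloc 0, P.alloc 1} : Finset (Finset (Fin m))).card ≤ 2 := card_le_two
    -- The output is treated as revealing its two bundles, which accounts for the 2 in the budget.
    -- Once dead, neither is a local maximum.
    obtain ⟨r', ⟨B, -, hr'⟩, hag⟩ := hr.exists_query hm {P.alloc 0, P.alloc 1}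
      (by omega)
    refine ⟨r', hag, Or.inr fun i hi => (hr' _ hi (Splitting.notMem_live ?_)).2⟩
    rw [mem_union, mem_insert, mem_singleton]
    fin_cases i
    · exact Or.inr (Or.inl rfl)
    · exact Or.inr (Or.inr rfl)
  | ask q f ih =>
    intro t Q r hQ hr
    cases t with
    | zero => exact ⟨r, fun _ _ => ⟨rfl, rfl⟩, Or.inl (Nat.succ_pos _)⟩
    | succ t =>
      set R : Finset (Finset (Fin m)) := univ.filter fun T => T ∈ near q.center with hR
      have hRc : R.card ≤ (m + 1) ^ 400 := card_near_le _
      have hQR := card_union_le Q R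
      rw [Nat.succ_mul] at hQ
      obtain ⟨r₁, hr₁, hag₁⟩ := hr.exists_query hm R (by omega)
      obtain ⟨r₂, hag₂, h⟩ := ih (r₁.toSensitive.answer τ q) t (Q ∪ R) r₁ (by omega) hr₁
      -- The answer was fixed under r₁. Later changes stay inside the live region, which avoids
      -- every bundle near the center, so the final ranking gives the same answer.
      have hans : r₁.toSensitive.answer τ q = r₂.toSensitive.answer τ q := by
        refine Sensitive.answer_congr hm (by omega) τ q fun T hT _ => ?_
        have hTR : T ∈ Q ∪ R := mem_union_right _ (mem_filter.2 ⟨mem_univ _, hT⟩)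
        obtain ⟨h1, h2⟩ := hag₂ T (Splitting.notMem_live hTR)
        exact ⟨congrArg rankValue h1.symm, h2.symm⟩
      refine ⟨r₂, hag₁.trans (Splitting.live_anti subset_union_left) hag₂, ?_⟩
      rw [hans] at h
      exact h.imp (fun h => Nat.succ_lt_succ h) fun h => h

end Ranking

end Adversary

/-- A lower bound for the number of queries, without asymptotic estimates. -/
theorem exists_queryCount_gt {m : ℕ} (hm : Odd m) (hm' : 60 ≤ m) (τ : Fin 2 → TieBreaking m)
    (A : Algorithm m)
    (hA : ∀ (d : Sensitive m) (O : Finset (Fin m) → Clause m), IsXOSOracle d.clauses O →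
      IsTraditionalEquilibrium (fun _ => d.valuation) (fun _ => O)
        (A.run (Query.answer (fun _ => d.valuation) (fun _ => O) τ)))
    {t : ℕ} (ht : t * (m + 1) ^ 400 + 2 < (m / 2).choose (m / 2 / 2)) :
    ∃ (d : Sensitive m) (O : Finset (Fin m) → Clause m), IsXOSOracle d.clauses O ∧
      t < A.queryCount (Query.answer (fun _ => d.valuation) (fun _ => O) τ) := by
  obtain ⟨s⟩ := Splitting.exists hm
  obtain ⟨r₀, hr₀⟩ := Ranking.exists_climbs_live_empty hm s
  obtain ⟨r, -, h⟩ := hr₀.exists_adversary hm hm' s τ A t ∅ r₀ (by simpa using ht)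
  have hO := r.toSensitive.isXOSOracle_localOracle
  -- With few queries the output would contain no local maximum, although as a traditional
  -- equilibrium it must.
  refine ⟨r.toSensitive, r.toSensitive.localOracle, hO, h.resolve_right fun h => ?_⟩
  obtain ⟨i, hi, hle⟩ := (hA _ _ hO).exists_local_max hm hm' hO
  exact (rankValue_strictMono (h i hi)).not_ge hle

/-- The number of lines exceeds every polynomial times `2 ^ (m / 8)`. -/
theorem eventually_pow_mul_lt_choose (k : ℕ) :
    ∀ᶠ m : ℕ in Filter.atTop, ∀ t : ℕ, (t : ℝ) ≤ (2 : ℝ) ^ ((1 / 8 : ℝ) * m) →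
      t * (m + 1) ^ k + 2 < (m / 2).choose (m / 2 / 2) := by
  have hlim : Filter.Tendsto (fun n : ℕ => (n : ℝ) ^ (k + 2) / ((2 : ℝ) ^ (1 / 4 : ℝ)) ^ n)
      Filter.atTop (nhds 0) :=
    tendsto_pow_const_div_const_pow_of_one_lt (k + 2) (Real.one_lt_rpow (by norm_num) (by norm_num))
  have hlim' := (hlim.comp (Filter.tendsto_add_atTop_nat 1)).eventually_lt_const
    (show (0 : ℝ) < 1 / 8 by norm_num)
  filter_upwards [hlim', Filter.eventually_ge_atTop 60] with m h hm t ht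
  have hq : 0 < (2 : ℝ) ^ (1 / 4 : ℝ) := Real.rpow_pos_of_pos (by norm_num) _
  simp only [Function.comp, Nat.cast_add, Nat.cast_one] at h
  rw [div_lt_iff₀ (by positivity), ← Real.rpow_natCast (2 ^ (1 / 4 : ℝ)),
    ← Real.rpow_mul (by norm_num)] at h
  -- The middle binomial coefficient is at least the average of its row. Its factor m + 1 is one of
  -- the two extra powers in k + 2; the other leaves room for the additive 2.
  have hsum : 2 ^ (m / 2) ≤ (m + 1) * (m / 2).choose (m / 2 / 2) := by
    rw [← Nat.sum_range_choose]
    refine (Finset.sum_le_card_nsmul _ _ _ fun i _ => Nat.choose_le_middle i (m / 2)).trans ?_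
    rw [card_range, smul_eq_mul]
    exact Nat.mul_le_mul_right _ (by omega)
  have hsum' : (2 : ℝ) ^ (m / 2) ≤ ((m : ℝ) + 1) * ((m / 2).choose (m / 2 / 2) : ℕ) := by
    exact_mod_cast hsum
  -- The exponent m/2 is split into m/8 for the query bound and about m/4 to absorb the polynomial;
  -- the rest is slack.
  have h2 : (2 : ℝ) ^ ((1 / 8 : ℝ) * m) * 2 ^ ((1 / 4 : ℝ) * ((m + 1 : ℕ) : ℝ)) ≤
      2 ^ (m / 2) * 2 := by
    rw [← Real.rpow_add (by norm_num), ← pow_succ, ← Real.rpow_natCast]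
    refine Real.rpow_le_rpow_of_exponent_le (by norm_num) ?_
    have hmm : (m : ℝ) ≤ 2 * ((m / 2 : ℕ) : ℝ) + 1 := by
      have : m ≤ 2 * (m / 2) + 1 := by omega
      exact_mod_cast this
    have : (60 : ℝ) ≤ m := by exact_mod_cast hm
    push_cast
    linarith
  have h1 : (1 : ℝ) ≤ (2 : ℝ) ^ ((1 / 8 : ℝ) * m) :=
    Real.one_le_rpow (by norm_num) (by positivity)
  set x : ℝ := (2 : ℝ) ^ ((1 / 8 : ℝ) * m) with hx
  have hmain : x * ((m : ℝ) + 1) ^ (k + 2) * 4 < 2 ^ (m / 2) := by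
    have := mul_lt_mul_of_pos_left h (zero_lt_one.trans_le h1)
    push_cast at h2 this
    linarith
  have hm1 : (61 : ℝ) ≤ (m : ℝ) + 1 := by
    have : (60 : ℝ) ≤ m := by exact_mod_cast hm
    linarith
  have hpow : (1 : ℝ) ≤ ((m : ℝ) + 1) ^ k := one_le_pow₀ (by linarith)
  have hfin : (t : ℝ) * ((m : ℝ) + 1) ^ k + 2 < ((m / 2).choose (m / 2 / 2) : ℕ) := by
    have hlt := hmain.trans_le hsum'
    have e : x * ((m : ℝ) + 1) ^ (k + 2) * 4 =
        ((m : ℝ) + 1) * (x * ((m : ℝ) + 1) ^ k * (((m : ℝ) + 1) * 4)) := by ring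
    rw [e] at hlt
    have hlt' := lt_of_mul_lt_mul_left hlt (by linarith)
    have h3 : (t : ℝ) * ((m : ℝ) + 1) ^ k ≤ x * ((m : ℝ) + 1) ^ k :=
      mul_le_mul_of_nonneg_right ht (by linarith)
    have h4 : 1 ≤ x * ((m : ℝ) + 1) ^ k := one_le_mul_of_one_le_of_one_le h1 hpow
    have h5 : x * ((m : ℝ) + 1) ^ k * 4 ≤ x * ((m : ℝ) + 1) ^ k * (((m : ℝ) + 1) * 4) :=
      mul_le_mul_of_nonneg_left (by linarith) (by linarith)
    linarith
  exact_mod_cast hfin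

end TradEq

/-- Any deterministic algorithm that uses value, demand and XOS queries and always finds a
traditional equilibrium makes exponentially many queries in the worst case. This holds even if
the algorithm only has to be correct for two bidders with the same sensitive valuation and the
same standard XOS oracle, and whatever (fixed) rule breaks the ties in demand queries. -/
theorem mainTheorem4 :
    ∃ c : ℝ, 0 < c ∧ ∃ m₀ : ℕ, ∀ m : ℕ, m₀ ≤ m → Odd m →
      ∀ (τ : Fin 2 → TradEq.TieBreaking m) (A : TradEq.Algorithm m),
        (∀ (d : TradEq.Sensitive m) (O : Finset (Fin m) → TradEq.Clause m),
          TradEq.IsXOSOracle d.clauses O →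
            TradEq.IsTraditionalEquilibrium (fun _ => d.valuation) (fun _ => O)
              (A.run (TradEq.Query.answer (fun _ => d.valuation) (fun _ => O) τ))) →
        ∃ (d : TradEq.Sensitive m) (O : Finset (Fin m) → TradEq.Clause m),
          TradEq.IsXOSOracle d.clauses O ∧
          (2 : ℝ) ^ (c * (m : ℝ)) ≤
            (A.queryCount (TradEq.Query.answer (fun _ => d.valuation) (fun _ => O) τ) : ℝ) := by
  obtain ⟨m₁, h₁⟩ := Filter.eventually_atTop.1 (TradEq.eventually_pow_mul_lt_choose 400)
  refine ⟨1 / 8, by norm_num, max m₁ 60, fun m hm hodd τ A hA => ?_⟩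
  obtain ⟨d, O, hO, hlt⟩ := TradEq.exists_queryCount_gt hodd (le_of_max_le_right hm) τ A hA
    (h₁ m (le_of_max_le_left hm) ⌊(2 : ℝ) ^ ((1 / 8 : ℝ) * m)⌋₊
      (Nat.floor_le (Real.rpow_nonneg (by norm_num) _)))
  exact ⟨d, O, hO, ((Nat.floor_lt (Real.rpow_nonneg (by norm_num) _)).1 hlt).le⟩
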